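/- **Setting.** Let $L^2=L^2(\mathbb T,m)$ and $L^\infty=L^\infty(\mathbb T,m)$, where $m$ is normalized Lebesgue measure on the unit circle. Let $H^2$ (resp. $H^\infty$) be the space of those functions in $L^2$ (resp. $L^\infty$) whose Fourier coefficients of negative index vanish, i.e. the Hardy space of the disc identified with its boundary functions. An *inner* function is a $\theta\in H^\infty$ with $|\theta|=1$ a.e. on $\mathbb T$. For inner $\alpha,\theta$ we say that $\alpha$ *divides* $\theta$ ($\alpha\leqslant\theta$) if $\theta/\alpha=\bar\alpha\theta$ is inner; $GCD(\alpha,\theta)$ denotes a greatest common divisor with respect to $\leqslant$, determined up to a unimodular constant. A function $g\in H^2$ is *outer* if the functions $z^ng$, $n\ge 0$, span a dense subspace of $H^2$; an *inner factor* of $f\in H^2$, $f\neq 0$, is an inner function $f_i$ with $f=f_if_o$ for some outer $f_o$, also determined up to a unimodular constant. The model space of an inner function $\theta$ is $K^2_\theta=H^2\ominus\theta H^2$, and $P_\theta$ is the orthogonal projection of $L^2$ onto $K^2_\theta$. For $\varphi\in L^\infty$ let $A_\varphi^{\theta,\alpha}\colon K^2_\theta\to K^2_\alpha$ be the bounded operator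 $A_\varphi^{\theta,\alpha}f=P_\alpha(\varphi f)$. **Theorem.** Let $\alpha$ and $\theta$ be nonconstant inner functions and let $\varphi\in H^\infty$, $\varphi\neq0$. Then $\varphi$ has an inner factor. Let $\varphi_i$ be any inner factor of $\varphi$. Then $\alpha$ and $\varphi_i$ have a greatest common divisor. Let $\psi=GCD(\alpha,\varphi_i)$ be any such divisor. 1. $\ker A_\varphi^{\theta,\alpha}=K^2_\theta\cap\frac{\alpha}{\psi}H^2$; in particular, if $\frac{\alpha}{\psi}\leqslant\theta$, then $\ker A_\varphi^{\theta,\alpha}=\frac{\alpha}{\psi}K^2_{\theta\psi/\alpha}$. 2. If $\theta\leqslant\alpha$, then $\theta$ and $\psi$ have a greatest common divisor, and $\ker A_{\bar\varphi}^{\theta,\alpha}=\ker\big(A_\varphi^{\alpha,\theta}\big)^*=K^2_{GCD(\theta,\psi)}$ for every choice of $GCD(\theta,\psi)$. -/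

import Mathlib

open MeasureTheory AddCircle
open scoped ENNReal

noncomputable section

namespace HardyCircle

/-- Normalized Lebesgue measure `m` on the unit circle; the circle is parametrized by `t ↦ exp (2 π i t)`,
with `t` modulo `1`, so that `fourier n` is the function `z ↦ z ^ n`. -/
abbrev m : Measure UnitAddCircle := haarAddCircle

/-- The Hilbert space `L² = L²(𝕋, m)`. -/
abbrev L2 : Type := Lp ℂ 2 m

/-- The space `L^∞ = L^∞(𝕋, m)`. -/
abbrev Linf : Type := Lp ℂ ∞ m

/-- The pointwise product of two elements of `L^∞`. -/
def mul (u v : Linf) : Linf := u • v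

/-- The quotient `b / a`, for `a` unimodular: it is the product of `b` and the complex conjugate
of `a`. -/
def quot (b a : Linf) : Linf := mul b (star a)

/-- The multiplication operator `f ↦ u f` on `L²`, for `u ∈ L^∞`. -/
def M (u : Linf) : L2 →L[ℂ] L2 := (ContinuousLinearMap.mul ℂ ℂ).holderL m ∞ 2 2 u

/-- The inclusion of `L^∞` in `L²`. -/
def toL2 (u : Linf) : L2 := ((Lp.memLp u).mono_exponent le_top).toLp u

/-- The Hardy space `H²`, as the closed subspace of `L²` of the functions whose Fourier
coefficients of negative index all vanish. -/
def H2 : Submodule ℂ L2 where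
  carrier := {f | ∀ n : ℤ, n < 0 → fourierCoeff f n = 0}
  add_mem' {f g} hf hg n hn := by
    rw [← fourierBasis_repr, map_add, lp.coeFn_add, Pi.add_apply, fourierBasis_repr,
      fourierBasis_repr, hf n hn, hg n hn, add_zero]
  zero_mem' n _ := by
    rw [← fourierBasis_repr, map_zero, lp.coeFn_zero, Pi.zero_apply]
  smul_mem' c f hf n hn := by
    rw [← fourierBasis_repr, map_smul, lp.coeFn_smul, Pi.smul_apply, fourierBasis_repr,
      hf n hn, smul_zero]

theorem isClosed_H2 : IsClosed (H2 : Set L2) := by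
  have h : (H2 : Set L2) =
      ⋂ n : ℤ, ⋂ _ : n < 0, {f : L2 | inner ℂ (fourierBasis (T := 1) n) f = 0} := by
    ext f
    simp only [Set.mem_iInter, Set.mem_ofPred_eq, ← HilbertBasis.repr_apply_apply,
      fourierBasis_repr]
    rfl
  rw [h]
  exact isClosed_iInter fun n => isClosed_iInter fun _ =>
    isClosed_eq (continuous_const.inner continuous_id) continuous_const

/-- Membership in `H^∞`: the essentially bounded functions on the circle whose Fourier
coefficients of negative index all vanish (boundary functions of the bounded analytic functions
on the unit disc). -/
def IsHinf (u : Linf) : Prop := ∀ n : ℤ, n < 0 → fourierCoeff u n = 0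

/-- Inner functions: members of `H^∞` of modulus one almost everywhere on the circle. -/
def IsInner (u : Linf) : Prop := IsHinf u ∧ ∀ᵐ x ∂m, ‖u x‖ = 1

/-- `u` is (almost everywhere equal to) a constant. -/
def IsConst (u : Linf) : Prop := ∃ c : ℂ, ∀ᵐ x ∂m, u x = c

/-- Divisibility `a ≤ b` of inner functions: the quotient `b / a` is inner. -/
def Divides (a b : Linf) : Prop := IsInner (quot b a)

/-- `d` is a greatest common divisor of the inner functions `a` and `b`. -/
def IsGCD (d a b : Linf) : Prop :=
  IsInner d ∧ Divides d a ∧ Divides d b ∧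
    ∀ e : Linf, IsInner e → Divides e a → Divides e b → Divides e d

/-- Outer functions of `H²` (Beurling's definition): the products `z ^ n g`, `n ≥ 0`, span a dense
subspace of `H²`. -/
def IsOuter (g : L2) : Prop :=
  (Submodule.span ℂ (Set.range fun n : ℕ => M (fourierLp ∞ (n : ℤ)) g)).topologicalClosure = H2

/-- `u` is an inner factor of `f ∈ H²`: `f = u g` with `u` inner and `g` outer. -/
def IsInnerFactor (u : Linf) (f : L2) : Prop :=
  IsInner u ∧ ∃ g : L2, IsOuter g ∧ f = M u g

/-- The subspace `u S = {u f : f ∈ S}` of `L²`. -/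
def mulSpace (u : Linf) (S : Submodule ℂ L2) : Submodule ℂ L2 := S.map (M u : L2 →ₗ[ℂ] L2)

/-- The model space `K²_θ = H² ⊖ θ H²`. -/
def K (θ : Linf) : Submodule ℂ L2 := H2 ⊓ (mulSpace θ H2)ᗮ

instance (θ : Linf) : CompleteSpace (K θ) :=
  (isClosed_H2.inter (mulSpace θ H2).isClosed_orthogonal).completeSpace_coe

/-- The asymmetric truncated Toeplitz operator `A_φ^{θ,α} : K²_θ → K²_α`, `f ↦ P_α (φ f)`, with
bounded symbol `φ`, where `P_α` is the orthogonal projection of `L²` onto `K²_α`. -/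
def A (φ θ α : Linf) : K θ →L[ℂ] K α :=
  (K α).orthogonalProjectionOnto ∘L M φ ∘L (K θ).subtypeL

/-- The kernel of an operator on `K²_θ`, as a subspace of `L²`. -/
def kerL2 {θ α : Linf} (B : K θ →L[ℂ] K α) : Submodule ℂ L2 :=
  (LinearMap.ker (B : K θ →ₗ[ℂ] K α)).map (K θ).subtype

end HardyCircle

end

noncomputable section

namespace HardyCircle


/-! Beurling's theorem (`exists_isInner_eq_mulSpace`) turns divisibility into geometry: `a` divides
`b` iff `bH² ⊆ aH²`, so a gcd of `a` and `b` is an inner generator of the closure of `aH² + bH²`.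
Applied to the cyclic space of `φ`, it also yields an inner factor.

For `f` in `K θ`, `φf` lies in `H²`, so `f` is in the kernel iff `ᾱφf ∈ H²`. The `k` with `kᾱf ∈ H²`
form a closed shift invariant space containing `α`; if it contains `φ`, it contains `φi H²`, hence
`ψH²`, hence `ψ`, which says `f ∈ (α/ψ)H²` (`kerL2_A_eq`).

For the symbol `φ̄` and `θ` dividing `α`, the kernel consists of the `f` in `K θ` orthogonal to
`φH²`, equivalently to `φi H²`. Orthogonal complements turn closed sums into intersections, which
gives the gcd of `θ` and `ψ` (`kerL2_A_star_eq`). -/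

/-! ### Multiplication operators and characters. -/

theorem coeFn_M (u : Linf) (f : L2) : M u f =ᵐ[m] fun x => u x * f x :=
  (ContinuousLinearMap.mul ℂ ℂ).coeFn_holder u f

theorem coeFn_mul (u v : Linf) : mul u v =ᵐ[m] fun x => u x * v x :=
  Lp.coeFn_lpSMul u v

theorem coeFn_toL2 (u : Linf) : toL2 u =ᵐ[m] u := MemLp.coeFn_toLp _

theorem coeFn_star (u : Linf) : (star u : Linf) =ᵐ[m] fun x => star (u x) := Lp.coeFn_star u

theorem toL2_injective : Function.Injective toL2 := fun u v h => by
  apply Lp.ext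
  have h' := coeFn_toL2 v
  rw [← h] at h'
  exact (coeFn_toL2 u).symm.trans h'

theorem M_mul (u v : Linf) (f : L2) : M (mul u v) f = M u (M v f) := by
  apply Lp.ext
  filter_upwards [coeFn_M (mul u v) f, coeFn_M u (M v f), coeFn_M v f, coeFn_mul u v]
    with x h1 h2 h3 h4
  rw [h1, h2, h3, h4, mul_assoc]

theorem M_comm (u v : Linf) (f : L2) : M u (M v f) = M v (M u f) := by
  apply Lp.ext
  filter_upwards [coeFn_M v (M u f), coeFn_M u (M v f), coeFn_M v f, coeFn_M u f]
    with x h1 h2 h3 h4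
  rw [h1, h2, h3, h4, mul_left_comm]

theorem M_quot (u v : Linf) (f : L2) : M (quot u v) f = M (star v) (M u f) := by
  rw [quot, M_mul, M_comm]

theorem inner_M_left (u : Linf) (f g : L2) : inner ℂ (M u f) g = inner ℂ f (M (star u) g) := by
  rw [L2.inner_def, L2.inner_def]
  apply integral_congr_ae
  filter_upwards [coeFn_M u f, coeFn_M (star u) g, coeFn_star u] with x h1 h2 h3
  simp only [h1, h2, h3, RCLike.inner_apply, map_mul, starRingEnd_apply]
  ring

theorem inner_M_right (u : Linf) (f g : L2) : inner ℂ f (M u g) = inner ℂ (M (star u) f) g := by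
  rw [inner_M_left, star_star]

theorem star_fourierLp (k : ℤ) :
    star (fourierLp ∞ k : Linf) = (fourierLp ∞ (-k) : Linf) := by
  apply Lp.ext
  filter_upwards [coeFn_star (fourierLp ∞ k : Linf), coeFn_fourierLp (T := 1) ∞ k,
    coeFn_fourierLp (T := 1) ∞ (-k)] with x h1 h2 h3
  rw [h1, h2, h3, fourier_neg]
  rfl

theorem M_fourierLp (k n : ℤ) :
    M (fourierLp ∞ k) (fourierLp 2 n) = fourierLp 2 (k + n) := by
  apply Lp.ext
  filter_upwards [coeFn_M (fourierLp ∞ k) (fourierLp 2 n), coeFn_fourierLp (T := 1) ∞ k,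
    coeFn_fourierLp (T := 1) 2 n, coeFn_fourierLp (T := 1) 2 (k + n)] with x h1 h2 h3 h4
  rw [h1, h2, h3, h4, fourier_add]

theorem M_fourierLp_add (k n : ℤ) (f : L2) :
    M (fourierLp ∞ (k + n)) f = M (fourierLp ∞ k) (M (fourierLp ∞ n) f) := by
  rw [← M_mul]
  congr 2
  apply Lp.ext
  filter_upwards [coeFn_mul (fourierLp ∞ k) (fourierLp ∞ n), coeFn_fourierLp (T := 1) ∞ k,
    coeFn_fourierLp (T := 1) ∞ n, coeFn_fourierLp (T := 1) ∞ (k + n)] with x h1 h2 h3 h4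
  rw [h1, h2, h3, h4, fourier_add]

theorem M_fourierLp_zero (f : L2) : M (fourierLp ∞ 0) f = f := by
  apply Lp.ext
  filter_upwards [coeFn_M (fourierLp ∞ 0) f, coeFn_fourierLp (T := 1) ∞ 0] with x h1 h2
  rw [h1, h2, fourier_zero, one_mul]

theorem M_one (u : Linf) : M u (fourierLp 2 0) = toL2 u := by
  apply Lp.ext
  filter_upwards [coeFn_M u (fourierLp 2 0), coeFn_toL2 u,
    coeFn_fourierLp (T := 1) 2 0] with x h1 h2 h3
  rw [h1, h2, h3, fourier_zero, mul_one]

/-! ### Hardy space, its bounded multipliers and divisibility. -/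

theorem inner_fourierLp (n : ℤ) (f : L2) :
    inner ℂ (fourierLp 2 n) f = fourierCoeff f n := by
  rw [← fourierBasis_repr, HilbertBasis.repr_apply_apply, coe_fourierBasis]

theorem mem_H2 {f : L2} : f ∈ H2 ↔ ∀ n : ℤ, n < 0 → inner ℂ (fourierLp 2 n) f = 0 := by
  simp only [inner_fourierLp]
  rfl

theorem isHinf_iff {u : Linf} : IsHinf u ↔ toL2 u ∈ H2 := by
  simp only [IsHinf, H2, Submodule.mem_mk, AddSubmonoid.mem_mk, AddSubsemigroup.mem_mk]
  simp only [← fourierCoeff_congr_ae (coeFn_toL2 u)]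
  rfl

theorem eq_zero_of_inner_fourierLp {f : L2}
    (h : ∀ n : ℤ, inner ℂ (fourierLp 2 n) f = 0) : f = 0 := by
  apply (fourierBasis (T := 1)).repr.injective
  ext n
  rw [HilbertBasis.repr_apply_apply, coe_fourierBasis, h, map_zero]
  rfl

theorem M_star_M {u : Linf} (hu : ∀ᵐ x ∂m, ‖u x‖ = 1) (f : L2) : M (star u) (M u f) = f := by
  apply Lp.ext
  filter_upwards [coeFn_M (star u) (M u f), coeFn_M u f, coeFn_star u, hu] with x h1 h2 h3 h4
  rw [h1, h2, h3, ← mul_assoc, ← starRingEnd_apply, RCLike.conj_mul, h4]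
  simp

theorem M_M_star {u : Linf} (hu : ∀ᵐ x ∂m, ‖u x‖ = 1) (f : L2) : M u (M (star u) f) = f := by
  rw [M_comm, M_star_M hu]

theorem norm_quot {u v : Linf} (hu : ∀ᵐ x ∂m, ‖u x‖ = 1) (hv : ∀ᵐ x ∂m, ‖v x‖ = 1) :
    ∀ᵐ x ∂m, ‖quot u v x‖ = 1 := by
  filter_upwards [hu, hv, coeFn_mul u (star v), coeFn_star v] with x h1 h2 h3 h4
  rw [quot, h3, h4, norm_mul, norm_star, h1, h2, one_mul]

theorem fourierLp_mem_H2 (n : ℕ) : (fourierLp 2 (n : ℤ) : L2) ∈ H2 := by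
  rw [mem_H2]
  intro k hk
  exact (orthonormal_fourier (T := 1)).2 (by omega)

/-- A closed subspace containing all `z ^ n`, `n ≥ 0`, contains `H²`. -/
theorem H2_le_of_fourierLp_mem {N : Submodule ℂ L2} (hN : IsClosed (N : Set L2))
    (h : ∀ n : ℕ, (fourierLp 2 (n : ℤ) : L2) ∈ N) : H2 ≤ N := by
  intro f hf
  have hs := hasSum_fourier_series_L2 (T := 1) f
  refine hN.mem_of_tendsto hs (Filter.Eventually.of_forall fun s => N.sum_mem fun n _ => ?_)
  rcases lt_or_ge n 0 with hn | hn
  · rw [hf n hn, zero_smul]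
    exact N.zero_mem
  · lift n to ℕ using hn
    exact N.smul_mem _ (h n)

theorem isClosed_comap_M (u : Linf) {N : Submodule ℂ L2} (hN : IsClosed (N : Set L2)) :
    IsClosed ((N.comap (M u : L2 →ₗ[ℂ] L2) : Submodule ℂ L2) : Set L2) :=
  hN.preimage (M u).continuous

theorem M_fourierLp_mem_H2 {f : L2} (hf : f ∈ H2) (n : ℕ) : M (fourierLp ∞ (n : ℤ)) f ∈ H2 := by
  rw [mem_H2] at hf ⊢
  intro k hk
  rw [inner_M_right, star_fourierLp, M_fourierLp]
  exact hf _ (by omega)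

theorem M_mem_H2 {u : Linf} (hu : IsHinf u) {f : L2} (hf : f ∈ H2) : M u f ∈ H2 := by
  refine H2_le_of_fourierLp_mem (isClosed_comap_M u isClosed_H2) (fun n => ?_) hf
  have : (fourierLp 2 (n : ℤ) : L2) = M (fourierLp ∞ (n : ℤ)) (fourierLp 2 0) := by
    rw [M_fourierLp, add_zero]
  rw [Submodule.mem_comap, this]
  change M u (M _ _) ∈ H2
  rw [M_comm, M_one]
  exact M_fourierLp_mem_H2 (isHinf_iff.1 hu) n

theorem mem_mulSpace {u : Linf} (hu : ∀ᵐ x ∂m, ‖u x‖ = 1) {S : Submodule ℂ L2} {f : L2} :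
    f ∈ mulSpace u S ↔ M (star u) f ∈ S := by
  constructor
  · rintro ⟨g, hg, rfl⟩
    change M (star u) (M u g) ∈ S
    rwa [M_star_M hu]
  · exact fun h => ⟨_, h, M_M_star hu f⟩

theorem isClosed_mulSpace {u : Linf} (hu : ∀ᵐ x ∂m, ‖u x‖ = 1) :
    IsClosed (mulSpace u H2 : Set L2) := by
  convert isClosed_H2.preimage (M (star u)).continuous
  ext f
  exact mem_mulSpace hu

theorem M_mem_mulSpace {u : Linf} {S : Submodule ℂ L2} {f : L2} (hf : f ∈ S) :
    M u f ∈ mulSpace u S := ⟨f, hf, rfl⟩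

theorem IsInner.mulSpace_le {u : Linf} (hu : IsInner u) : mulSpace u H2 ≤ H2 := by
  rintro _ ⟨f, hf, rfl⟩
  exact M_mem_H2 hu.1 hf

theorem divides_iff_toL2_mem {a b : Linf} (ha : IsInner a) (hb : IsInner b) :
    Divides a b ↔ toL2 b ∈ mulSpace a H2 := by
  rw [mem_mulSpace ha.2, ← M_one b, ← M_quot, M_one, ← isHinf_iff, Divides, IsInner]
  exact and_iff_left (norm_quot hb.2 ha.2)

/-- The quotient `āb` multiplies `H²` into itself when it is inner; conversely, testing the
inclusion on the constant `1` recovers it. -/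
theorem divides_iff {a b : Linf} (ha : IsInner a) (hb : IsInner b) :
    Divides a b ↔ mulSpace b H2 ≤ mulSpace a H2 := by
  constructor
  · rintro h _ ⟨f, hf, rfl⟩
    rw [mem_mulSpace ha.2]
    change M (star a) (M b f) ∈ H2
    rw [← M_quot]
    exact M_mem_H2 h.1 hf
  · intro h
    rw [divides_iff_toL2_mem ha hb, ← M_one]
    exact h (M_mem_mulSpace (by simpa using fourierLp_mem_H2 0))

theorem isInner_iff {u : Linf} (hu : ∀ᵐ x ∂m, ‖u x‖ = 1) : IsInner u ↔ toL2 u ∈ H2 := by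
  rw [IsInner, isHinf_iff, and_iff_left hu]


/-! ### Beurling's theorem. -/

/-- Both sides are continuous and linear in `f` and agree on the characters, whose span is dense in
the continuous functions. Thus `|u|² dm` and `dm` have the same integrals. -/
theorem inner_M_eq_of_forall_fourier {u : L2} (h0 : ‖u‖ = 1)
    (h : ∀ n : ℤ, n ≠ 0 → inner ℂ u (M (fourierLp ∞ n) u) = 0) (f : C(UnitAddCircle, ℂ)) :
    inner ℂ u (M (ContinuousMap.toLp ∞ m ℂ f) u) =
      inner ℂ (fourierLp 2 0 : L2) (M (ContinuousMap.toLp ∞ m ℂ f) (fourierLp 2 0)) := by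
  let T : C(UnitAddCircle, ℂ) →L[ℂ] L2 →L[ℂ] L2 :=
    ((ContinuousLinearMap.mul ℂ ℂ).holderL m ∞ 2 2) ∘L (ContinuousMap.toLp ∞ m ℂ)
  have key : (innerSL ℂ u ∘L T.flip u) =
      (innerSL ℂ (fourierLp 2 0 : L2) ∘L T.flip (fourierLp 2 0)) := by
    apply ContinuousLinearMap.ext_on
      (s := Set.range (@fourier 1))
    · rw [dense_iff_closure_eq, ← Submodule.topologicalClosure_coe, span_fourier_closure_eq_top]
      rfl
    · rintro _ ⟨n, rfl⟩
      change inner ℂ u (M (fourierLp ∞ n) u) =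
        inner ℂ (fourierLp 2 0 : L2) (M (fourierLp ∞ n) (fourierLp 2 0))
      rw [M_fourierLp]
      rcases eq_or_ne n 0 with rfl | hn
      · rw [M_fourierLp_zero, inner_self_eq_norm_sq_to_K, add_zero, inner_self_eq_norm_sq_to_K, h0,
          (orthonormal_fourier (T := 1)).1]
      · rw [h n hn, (orthonormal_fourier (T := 1)).2 (by simpa using hn.symm)]
  exact DFunLike.congr_fun key f

/-- A unit vector of `L²` that is orthogonal to all its translates `z ^ n u`, `n ≠ 0`,
is unimodular. -/
theorem norm_eq_one_of_inner_fourier {u : L2} (h0 : ‖u‖ = 1)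
    (h : ∀ n : ℤ, n ≠ 0 → inner ℂ u (M (fourierLp ∞ n) u) = 0) :
    ∀ᵐ x ∂m, ‖u x‖ = 1 := by
  have hmeas : Measurable fun x => ‖u x‖₊ ^ 2 :=
    ((Lp.stronglyMeasurable u).measurable.nnnorm).pow_const 2
  let P : Measure UnitAddCircle := m.withDensity fun x => ((‖u x‖₊ ^ 2 : NNReal) : ℝ≥0∞)
  have hint : Integrable (fun x => ‖u x‖ ^ 2) m := (Lp.memLp u).integrable_norm_pow (by norm_num)
  have hfin : IsFiniteMeasure P := by
    refine isFiniteMeasure_withDensity ?_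
    have := hint.2
    refine ne_of_lt (lt_of_le_of_lt (lintegral_mono fun x => ?_) this)
    simp [enorm_pow]
    rfl
  -- A finite measure is determined by its integrals of bounded continuous real functions.
  have hP : P = m := by
    apply ext_of_forall_integral_eq_of_IsFiniteMeasure
    intro f
    rw [integral_withDensity_eq_integral_smul hmeas]
    let g : C(UnitAddCircle, ℂ) := ⟨fun x => (f x : ℂ), by fun_prop⟩
    have := inner_M_eq_of_forall_fourier h0 h g
    rw [L2.inner_def, L2.inner_def] at this
    have e1 : ∫ x, (((‖u x‖₊ ^ 2) • f x : ℝ) : ℂ) ∂m =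
        ∫ x, inner ℂ (u x) (M (ContinuousMap.toLp ∞ m ℂ g) u x) ∂m := by
      apply integral_congr_ae
      filter_upwards [coeFn_M (ContinuousMap.toLp ∞ m ℂ g) u,
        ContinuousMap.coeFn_toLp (p := ∞) (𝕜 := ℂ) m g] with x h1 h2
      rw [h1, h2, RCLike.inner_apply, mul_assoc, RCLike.mul_conj]
      simp [g, NNReal.smul_def, mul_comm]
    have e2 : ∫ x, ((f x : ℝ) : ℂ) ∂m =
        ∫ x, inner ℂ ((fourierLp 2 0 : L2) x)
          (M (ContinuousMap.toLp ∞ m ℂ g) (fourierLp 2 0) x) ∂m := by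
      apply integral_congr_ae
      filter_upwards [coeFn_M (ContinuousMap.toLp ∞ m ℂ g) (fourierLp 2 0),
        ContinuousMap.coeFn_toLp (p := ∞) (𝕜 := ℂ) m g, coeFn_fourierLp (T := 1) 2 0]
        with x h1 h2 h3
      rw [h1, h2, RCLike.inner_apply, h3, fourier_zero]
      simp [g]
    rw [← e1, ← e2, integral_complex_ofReal, integral_complex_ofReal] at this
    exact_mod_cast this
  have h1 : P = m.withDensity fun _ => 1 := by
    rw [hP]; exact withDensity_one.symm
  have h2 := (withDensity_eq_iff_of_sigmaFinite (by fun_prop) (by fun_prop)).1 h1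
  filter_upwards [h2] with x hx
  have hx' : ‖u x‖₊ ^ 2 = 1 := by exact_mod_cast hx
  have hx'' : ‖u x‖ ^ 2 = 1 := by
    simpa only [NNReal.coe_pow, coe_nnnorm, NNReal.coe_one] using congrArg NNReal.toReal hx'
  exact (pow_eq_one_iff_of_nonneg (norm_nonneg _) two_ne_zero).1 hx''

theorem exists_toL2_eq {u : L2} (hu : ∀ᵐ x ∂m, ‖u x‖ = 1) :
    ∃ v : Linf, toL2 v = u ∧ ∀ᵐ x ∂m, ‖v x‖ = 1 := by
  have hmem : MemLp u ∞ m :=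
    memLp_top_of_bound (Lp.aestronglyMeasurable u) 1 (hu.mono fun x hx => hx.le)
  have hv := hmem.coeFn_toLp
  refine ⟨hmem.toLp u, ?_, ?_⟩
  · exact Lp.ext ((coeFn_toL2 _).trans hv)
  · filter_upwards [hu, hv] with x h1 h2
    rw [h2, h1]

theorem M_fourierLp_mem {W : Submodule ℂ L2} (hz : ∀ f ∈ W, M (fourierLp ∞ 1) f ∈ W) {f : L2}
    (hf : f ∈ W) (n : ℕ) : M (fourierLp ∞ (n : ℤ)) f ∈ W := by
  induction n with
  | zero => simpa [M_fourierLp_zero] using hf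
  | succ n ih =>
    rw [Nat.cast_succ, add_comm, M_fourierLp_add]
    exact hz _ ih

theorem norm_fourierLp (k : ℤ) : ∀ᵐ x ∂m, ‖(fourierLp ∞ k : Linf) x‖ = 1 := by
  filter_upwards [coeFn_fourierLp (T := 1) ∞ k] with x hx
  rw [hx, fourier_apply]
  exact Circle.norm_coe _

theorem eq_zero_of_M_fourierLp_neg_mem_H2 {f : L2}
    (hf : ∀ n : ℕ, M (fourierLp ∞ (-(n : ℤ))) f ∈ H2) : f = 0 := by
  refine eq_zero_of_inner_fourierLp fun k => ?_
  -- Shifting back by `k.toNat + 1` moves the `k`-th coefficient to a negative index.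
  have h := mem_H2.1 (hf (k.toNat + 1)) (k - (k.toNat + 1)) (by omega)
  rw [inner_M_right, star_fourierLp, M_fourierLp] at h
  convert h using 3
  omega

/-- A nonzero closed shift invariant subspace of `H²` contains a unit vector orthogonal
to its image by the shift. -/
theorem exists_wandering_vector {W : Submodule ℂ L2} (hW : IsClosed (W : Set L2)) (hWH : W ≤ H2)
    (hW0 : W ≠ ⊥) (hz : ∀ f ∈ W, M (fourierLp ∞ 1) f ∈ W) :
    ∃ u ∈ W, ‖u‖ = 1 ∧ ∀ f ∈ W, inner ℂ (M (fourierLp ∞ 1) f) u = 0 := by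
  by_contra hne
  push Not at hne
  have hzc : IsClosed (mulSpace (fourierLp ∞ 1) W : Set L2) := by
    convert hW.preimage (M (star (fourierLp ∞ 1))).continuous
    ext f
    exact mem_mulSpace (norm_fourierLp 1)
  have : CompleteSpace (mulSpace (fourierLp ∞ 1) W) := hzc.completeSpace_coe
  -- Without a wandering vector, `zW = W`: the residual of `f` off `zW`, once normalized, would be
  -- one. Then `W` lies in every `zⁿH²`, so it is zero.
  have hdiv : ∀ f ∈ W, M (fourierLp ∞ (-1)) f ∈ W := by
    intro f hf
    rw [← star_fourierLp, ← mem_mulSpace (norm_fourierLp 1)]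
    set p := (mulSpace (fourierLp ∞ 1) W).starProjection f with hp
    have hpm : p ∈ mulSpace (fourierLp ∞ 1) W := Submodule.starProjection_apply_mem _ _
    have hpW : p ∈ W := by
      obtain ⟨g, hg, h⟩ := hpm
      rw [← h]
      exact hz g hg
    by_contra hfn
    have hw : f - p ≠ 0 := fun h => hfn (by rwa [sub_eq_zero.1 h])
    obtain ⟨g, hg, h⟩ := hne (((‖f - p‖⁻¹ : ℝ) : ℂ) • (f - p)) (W.smul_mem _ (W.sub_mem hf hpW))
      (by rw [norm_smul, Complex.norm_real, norm_inv, norm_norm,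
        inv_mul_cancel₀ (norm_ne_zero_iff.2 hw)])
    apply h
    rw [inner_smul_right, (Submodule.mem_orthogonal _ _).1
      (Submodule.sub_starProjection_mem_orthogonal f) _ (M_mem_mulSpace hg), mul_zero]
  apply hW0
  rw [Submodule.eq_bot_iff]
  intro f hf
  refine eq_zero_of_M_fourierLp_neg_mem_H2 fun n => hWH ?_
  induction n with
  | zero => simpa [M_fourierLp_zero] using hf
  | succ n ih =>
    rw [show -((n + 1 : ℕ) : ℤ) = -1 + -(n : ℤ) by push_cast; ring, M_fourierLp_add]
    exact hdiv _ ih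

/-- Beurling's theorem: nonzero closed shift invariant subspaces of `H²` are generated by
inner functions. -/
theorem exists_isInner_eq_mulSpace {W : Submodule ℂ L2} (hW : IsClosed (W : Set L2))
    (hWH : W ≤ H2) (hW0 : W ≠ ⊥) (hz : ∀ f ∈ W, M (fourierLp ∞ 1) f ∈ W) :
    ∃ u : Linf, IsInner u ∧ W = mulSpace u H2 := by
  obtain ⟨u₀, hu₀W, hu₀, horth⟩ := exists_wandering_vector hW hWH hW0 hz
  have horth' : ∀ f ∈ W, ∀ n : ℕ, inner ℂ u₀ (M (fourierLp ∞ ((n : ℤ) + 1)) f) = 0 := by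
    intro f hf n
    rw [add_comm, M_fourierLp_add, inner_eq_zero_symm]
    exact horth _ (M_fourierLp_mem hz hf n)
  have hmod : ∀ᵐ x ∂m, ‖u₀ x‖ = 1 := by
    refine norm_eq_one_of_inner_fourier hu₀ fun n hn => ?_
    rcases lt_or_gt_of_ne hn with h | h
    · rw [inner_M_right, star_fourierLp, inner_eq_zero_symm]
      obtain ⟨k, hk⟩ := Int.eq_ofNat_of_zero_le (show 0 ≤ -n - 1 by omega)
      rw [show -n = (k : ℤ) + 1 by omega]
      exact horth' _ hu₀W k
    · obtain ⟨k, hk⟩ := Int.eq_ofNat_of_zero_le (show 0 ≤ n - 1 by omega)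
      rw [show n = (k : ℤ) + 1 by omega]
      exact horth' _ hu₀W k
  obtain ⟨u, rfl, hu⟩ := exists_toL2_eq hmod
  have hui : IsInner u := (isInner_iff hu).2 (hWH hu₀W)
  have hle : mulSpace u H2 ≤ W := by
    rw [mulSpace, Submodule.map_le_iff_le_comap]
    refine H2_le_of_fourierLp_mem (isClosed_comap_M u hW) fun n => ?_
    change M u (fourierLp 2 (n : ℤ)) ∈ W
    rw [← add_zero (n : ℤ), ← M_fourierLp, M_comm, M_one]
    exact M_fourierLp_mem hz hu₀W n
  refine ⟨u, hui, le_antisymm (fun f hf => ?_) hle⟩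
  have : CompleteSpace (mulSpace u H2) := (isClosed_mulSpace hu).completeSpace_coe
  set p := (mulSpace u H2).starProjection f with hp
  have hpm : p ∈ mulSpace u H2 := Submodule.starProjection_apply_mem _ _
  have hgW : f - p ∈ W := W.sub_mem hf (hle hpm)
  -- Coefficients of index `≥ 0` vanish because the residual is orthogonal to `uH²`; those of
  -- negative index because `u` is orthogonal to `zW`.
  have hg : M (star u) (f - p) = 0 := by
    refine eq_zero_of_inner_fourierLp fun n => ?_
    rw [inner_M_right, star_star]
    rcases le_or_gt 0 n with h | h
    · lift n to ℕ using h
      exact (Submodule.mem_orthogonal _ _).1 (Submodule.sub_starProjection_mem_orthogonal f) _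
        (M_mem_mulSpace (fourierLp_mem_H2 n))
    · obtain ⟨k, hk⟩ := Int.eq_ofNat_of_zero_le (show 0 ≤ -n - 1 by omega)
      rw [← add_zero n, ← M_fourierLp, M_comm, M_one, inner_M_left, star_fourierLp,
        show -n = (k : ℤ) + 1 by omega]
      exact horth' _ hgW k
  have : f - p = 0 := by rw [← M_M_star hu (f - p), hg, map_zero]
  rwa [sub_eq_zero.1 this]


/-! ### Cyclic subspaces, outer functions and inner factors. -/

theorem mem_comap_M {u : Linf} {N : Submodule ℂ L2} {f : L2} :
    f ∈ N.comap (M u : L2 →ₗ[ℂ] L2) ↔ M u f ∈ N := Iff.rfl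

/-- The smallest shift invariant subspace containing `g`. -/
def cyclicSpan (g : L2) : Submodule ℂ L2 :=
  Submodule.span ℂ (Set.range fun n : ℕ => M (fourierLp ∞ (n : ℤ)) g)

theorem cyclicSpan_le {g : L2} {N : Submodule ℂ L2}
    (h : ∀ n : ℕ, M (fourierLp ∞ (n : ℤ)) g ∈ N) : cyclicSpan g ≤ N := by
  refine Submodule.span_le.2 ?_
  rintro _ ⟨n, rfl⟩
  exact h n

theorem M_mem_cyclicSpan (g : L2) (n : ℕ) : M (fourierLp ∞ (n : ℤ)) g ∈ cyclicSpan g :=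
  Submodule.subset_span ⟨n, rfl⟩

theorem self_mem_cyclicSpan (g : L2) : g ∈ cyclicSpan g := by
  simpa [M_fourierLp_zero] using M_mem_cyclicSpan g 0

theorem isOuter_iff {g : L2} : IsOuter g ↔ (cyclicSpan g).topologicalClosure = H2 := Iff.rfl

theorem M_cyclicSpan_mem (g : L2) : ∀ f ∈ cyclicSpan g, M (fourierLp ∞ 1) f ∈ cyclicSpan g := by
  have h : cyclicSpan g ≤ (cyclicSpan g).comap (M (fourierLp ∞ 1) : L2 →ₗ[ℂ] L2) := by
    refine cyclicSpan_le fun n => ?_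
    rw [mem_comap_M, ← M_fourierLp_add, add_comm]
    exact_mod_cast M_mem_cyclicSpan g (n + 1)
  exact fun f hf => mem_comap_M.1 (h hf)

theorem IsOuter.H2_le {g : L2} (hg : IsOuter g) {N : Submodule ℂ L2}
    (hN : IsClosed (N : Set L2)) (h : ∀ n : ℕ, M (fourierLp ∞ (n : ℤ)) g ∈ N) : H2 ≤ N := by
  rw [← isOuter_iff.1 hg]
  exact Submodule.topologicalClosure_minimal _ (cyclicSpan_le h) hN

theorem IsOuter.mem_H2 {g : L2} (hg : IsOuter g) : g ∈ H2 := by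
  rw [← isOuter_iff.1 hg]
  exact Submodule.le_topologicalClosure _ (self_mem_cyclicSpan g)

theorem mulSpace_le_of_toL2_mem {u : Linf} {N : Submodule ℂ L2} (hN : IsClosed (N : Set L2))
    (hz : ∀ f ∈ N, M (fourierLp ∞ 1) f ∈ N) (h : toL2 u ∈ N) : mulSpace u H2 ≤ N := by
  rw [mulSpace, Submodule.map_le_iff_le_comap]
  refine H2_le_of_fourierLp_mem (isClosed_comap_M u hN) fun n => ?_
  rw [mem_comap_M, ← add_zero (n : ℤ), ← M_fourierLp, M_comm, M_one]
  exact M_fourierLp_mem hz h n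

/-- The closed space of `h` with `uh ∈ N` contains every `zⁿg`, with `g` the outer factor, hence all
of `H²`. -/
theorem IsInnerFactor.mulSpace_le {u φ : Linf} (hu : IsInnerFactor u (toL2 φ))
    {N : Submodule ℂ L2} (hN : IsClosed (N : Set L2))
    (hz : ∀ f ∈ N, M (fourierLp ∞ 1) f ∈ N) (h : toL2 φ ∈ N) : mulSpace u H2 ≤ N := by
  obtain ⟨hui, g, hg, hφ⟩ := hu
  rw [mulSpace, Submodule.map_le_iff_le_comap]
  refine hg.H2_le (isClosed_comap_M u hN) fun n => ?_
  rw [mem_comap_M, M_comm, ← hφ]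
  exact M_fourierLp_mem hz h n

/-- The outer factor equals `ūφ`, so it is bounded and multiplies `H²` into itself. -/
theorem IsInnerFactor.M_mem {u φ : Linf} (hu : IsInnerFactor u (toL2 φ)) {f : L2} (hf : f ∈ H2) :
    M φ f ∈ mulSpace u H2 := by
  obtain ⟨hui, g, hg, hφ⟩ := hu
  have h : IsHinf (quot φ u) := by
    rw [isHinf_iff, ← M_one, M_quot, M_one, hφ, M_star_M hui.2]
    exact hg.mem_H2
  rw [mem_mulSpace hui.2, ← M_quot]
  exact M_mem_H2 h hf

theorem topologicalClosure_M_mem {S : Submodule ℂ L2} {u : Linf} (h : ∀ f ∈ S, M u f ∈ S) :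
    ∀ f ∈ S.topologicalClosure, M u f ∈ S.topologicalClosure := by
  have := S.topologicalClosure_minimal
    (t := S.topologicalClosure.comap (M u : L2 →ₗ[ℂ] L2))
    (fun f hf => S.le_topologicalClosure (h f hf))
    (isClosed_comap_M u S.isClosed_topologicalClosure)
  exact this

theorem M_mem_mulSpace_H2 (u : Linf) (f : L2) (hf : f ∈ mulSpace u H2) :
    M (fourierLp ∞ 1) f ∈ mulSpace u H2 := by
  obtain ⟨g, hg, rfl⟩ := hf
  change M _ (M _ g) ∈ _
  rw [M_comm]
  exact M_mem_mulSpace (M_fourierLp_mem_H2 hg 1)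

theorem toL2_ne_zero {u : Linf} (hu : u ≠ 0) : toL2 u ≠ 0 := by
  intro h
  apply hu
  apply toL2_injective
  rw [h, ← M_one, M, map_zero, zero_apply]

theorem isOuter_of_closure_cyclicSpan_eq {u : Linf} (hu : IsInner u) {f : L2}
    (h : (cyclicSpan f).topologicalClosure = mulSpace u H2) : IsOuter (M (star u) f) := by
  rw [isOuter_iff]
  refine le_antisymm ?_ fun k hk => ?_
  · refine Submodule.topologicalClosure_minimal _ (cyclicSpan_le fun n => ?_) isClosed_H2
    rw [M_comm, ← mem_mulSpace hu.2, ← h]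
    exact Submodule.le_topologicalClosure _ (M_mem_cyclicSpan f n)
  · have hle : mulSpace u H2 ≤
        (cyclicSpan (M (star u) f)).topologicalClosure.comap (M (star u) : L2 →ₗ[ℂ] L2) := by
      rw [← h]
      refine Submodule.topologicalClosure_minimal _ (cyclicSpan_le fun n => ?_)
        (isClosed_comap_M _ (Submodule.isClosed_topologicalClosure _))
      rw [mem_comap_M, M_comm]
      exact Submodule.le_topologicalClosure _ (M_mem_cyclicSpan _ n)
    have hk' := mem_comap_M.1 (hle (M_mem_mulSpace hk))
    rwa [M_star_M hu.2] at hk'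

theorem exists_isInnerFactor {φ : Linf} (hφ : IsHinf φ) (hφ0 : φ ≠ 0) :
    ∃ u : Linf, IsInnerFactor u (toL2 φ) := by
  have hmem : toL2 φ ∈ (cyclicSpan (toL2 φ)).topologicalClosure :=
    Submodule.le_topologicalClosure _ (self_mem_cyclicSpan _)
  obtain ⟨u, hu, h⟩ := exists_isInner_eq_mulSpace
    (Submodule.isClosed_topologicalClosure (cyclicSpan (toL2 φ)))
    (Submodule.topologicalClosure_minimal _
      (cyclicSpan_le (M_fourierLp_mem_H2 (isHinf_iff.1 hφ))) isClosed_H2)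
    (fun hbot => toL2_ne_zero hφ0 ((Submodule.mem_bot ℂ).1 (hbot ▸ hmem)))
    (topologicalClosure_M_mem (M_cyclicSpan_mem _))
  exact ⟨u, hu, _, isOuter_of_closure_cyclicSpan_eq hu h, (M_M_star hu.2 _).symm⟩

/-! ### Greatest common divisors as closed sums. -/

theorem exists_closure_sup_eq_mulSpace {a b : Linf} (ha : IsInner a) (hb : IsInner b) :
    ∃ d : Linf, IsInner d ∧ (mulSpace a H2 ⊔ mulSpace b H2).topologicalClosure = mulSpace d H2 := by
  refine exists_isInner_eq_mulSpace (Submodule.isClosed_topologicalClosure _)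
    (Submodule.topologicalClosure_minimal _ (sup_le ha.mulSpace_le hb.mulSpace_le) isClosed_H2)
    ?_ (topologicalClosure_M_mem ?_)
  · intro hbot
    have h0 : M a (fourierLp 2 0) ∈ (⊥ : Submodule ℂ L2) :=
      hbot ▸ Submodule.le_topologicalClosure _ (Submodule.mem_sup_left
        (M_mem_mulSpace (by simpa using fourierLp_mem_H2 0)))
    have h1 : (fourierLp 2 0 : L2) = 0 := by
      rw [← M_star_M ha.2 (fourierLp 2 0), (Submodule.mem_bot ℂ).1 h0, map_zero]
    have h2 := (orthonormal_fourier (T := 1)).1 0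
    rw [h1, norm_zero] at h2
    exact zero_ne_one h2
  · have : mulSpace a H2 ⊔ mulSpace b H2 ≤
        (mulSpace a H2 ⊔ mulSpace b H2).comap (M (fourierLp ∞ 1) : L2 →ₗ[ℂ] L2) :=
      sup_le (fun f hf => Submodule.mem_sup_left (M_mem_mulSpace_H2 a f hf))
        (fun f hf => Submodule.mem_sup_right (M_mem_mulSpace_H2 b f hf))
    exact this

theorem isGCD_of_closure_sup_eq {a b d : Linf} (ha : IsInner a) (hb : IsInner b) (hd : IsInner d)
    (h : (mulSpace a H2 ⊔ mulSpace b H2).topologicalClosure = mulSpace d H2) : IsGCD d a b := by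
  have hle := h ▸ Submodule.le_topologicalClosure (mulSpace a H2 ⊔ mulSpace b H2)
  refine ⟨hd, (divides_iff hd ha).2 (le_sup_left.trans hle),
    (divides_iff hd hb).2 (le_sup_right.trans hle), fun e he hea heb => ?_⟩
  rw [divides_iff he hd, ← h]
  exact Submodule.topologicalClosure_minimal _
    (sup_le ((divides_iff he ha).1 hea) ((divides_iff he hb).1 heb)) (isClosed_mulSpace he.2)

theorem exists_isGCD {a b : Linf} (ha : IsInner a) (hb : IsInner b) : ∃ d, IsGCD d a b :=
  let ⟨d, hd, h⟩ := exists_closure_sup_eq_mulSpace ha hb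
  ⟨d, isGCD_of_closure_sup_eq ha hb hd h⟩

/-- The Beurling generator of the closed sum is one gcd; any other divides it and is divided by it,
so generates the same space. -/
theorem IsGCD.closure_sup_eq {a b d : Linf} (ha : IsInner a) (hb : IsInner b) (h : IsGCD d a b) :
    (mulSpace a H2 ⊔ mulSpace b H2).topologicalClosure = mulSpace d H2 := by
  obtain ⟨e, he, heq⟩ := exists_closure_sup_eq_mulSpace ha hb
  obtain ⟨-, hea, heb, hemax⟩ := isGCD_of_closure_sup_eq ha hb he heq
  obtain ⟨hd, hda, hdb, hdmax⟩ := h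
  rw [heq]
  exact le_antisymm ((divides_iff hd he).1 (hemax d hd hda hdb))
    ((divides_iff he hd).1 (hdmax e he hea heb))

/-! ### Multipliers of an `L²` function into the Hardy space. -/

/-- The closed subspace of the `k ∈ L²` such that the Fourier coefficients of negative index
of `k G` vanish. -/
def multipliers (G : L2) : Submodule ℂ L2 :=
  (Submodule.span ℂ (Set.range fun n : ℕ => M (fourierLp ∞ (-((n : ℤ) + 1))) (star G)))ᗮ

theorem mem_multipliers {G k : L2} :
    k ∈ multipliers G ↔ ∀ n : ℕ, inner ℂ (M (fourierLp ∞ (-((n : ℤ) + 1))) (star G)) k = 0 := by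
  rw [multipliers, Submodule.mem_orthogonal]
  refine ⟨fun h n => h _ (Submodule.subset_span ⟨n, rfl⟩), fun h u hu => ?_⟩
  induction hu using Submodule.span_induction with
  | mem x hx =>
    obtain ⟨n, rfl⟩ := hx
    exact h n
  | zero => exact inner_zero_left _
  | add x y _ _ hx hy => rw [inner_add_left, hx, hy, add_zero]
  | smul c x _ hx => rw [inner_smul_left, hx, mul_zero]

/-- Pairing `u` with `zⁿḠ` gives the `n`-th Fourier coefficient of `uG`. The orthogonality form
makes sense, and is closed, even for unbounded `k`. -/
theorem toL2_mem_multipliers {G : L2} {u : Linf} : toL2 u ∈ multipliers G ↔ M u G ∈ H2 := by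
  have key : ∀ n : ℤ, inner ℂ (M (fourierLp ∞ n) (star G)) (toL2 u) =
      inner ℂ (fourierLp 2 n) (M u G) := by
    intro n
    rw [L2.inner_def, L2.inner_def]
    apply integral_congr_ae
    filter_upwards [coeFn_M (fourierLp ∞ n) (star G), Lp.coeFn_star G, coeFn_toL2 u,
      coeFn_fourierLp (T := 1) ∞ n, coeFn_fourierLp (T := 1) 2 n, coeFn_M u G]
      with x h1 h2 h3 h4 h5 h6
    rw [h1, h2, h3, h4, h5, h6]
    simp only [RCLike.inner_apply, map_mul, Pi.star_apply, ← starRingEnd_apply, RCLike.conj_conj]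
    ring
  simp only [mem_multipliers, mem_H2, key]
  refine ⟨fun h n hn => ?_, fun h n => h _ (by omega)⟩
  obtain ⟨k, hk⟩ := Int.eq_ofNat_of_zero_le (show 0 ≤ -n - 1 by omega)
  rw [show n = -((k : ℤ) + 1) by omega]
  exact h k

theorem M_mem_multipliers (G f : L2) (hf : f ∈ multipliers G) :
    M (fourierLp ∞ 1) f ∈ multipliers G := by
  rw [mem_multipliers] at hf ⊢
  intro n
  rw [inner_M_right, star_fourierLp, ← M_fourierLp_add]
  convert hf (n + 1) using 5
  push_cast
  ring

/-! ### Model spaces and kernels. -/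

theorem mem_K {θ : Linf} {f : L2} : f ∈ K θ ↔ f ∈ H2 ∧ f ∈ (mulSpace θ H2)ᗮ := Iff.rfl

theorem mem_mulSpace_orthogonal {u : Linf} {f : L2} :
    f ∈ (mulSpace u H2)ᗮ ↔ ∀ h ∈ H2, inner ℂ (M u h) f = 0 := by
  rw [Submodule.mem_orthogonal]
  refine ⟨fun h g hg => h _ (M_mem_mulSpace hg), ?_⟩
  rintro h _ ⟨g, hg, rfl⟩
  exact h g hg

theorem exists_mem_K_add {α : Linf} (hα : IsInner α) {h : L2} (hh : h ∈ H2) :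
    ∃ g ∈ K α, ∃ p ∈ mulSpace α H2, h = g + p := by
  have : CompleteSpace (mulSpace α H2) := (isClosed_mulSpace hα.2).completeSpace_coe
  have hp : (mulSpace α H2).starProjection h ∈ mulSpace α H2 :=
    Submodule.starProjection_apply_mem _ _
  exact ⟨_, ⟨H2.sub_mem hh (hα.mulSpace_le hp), Submodule.sub_starProjection_mem_orthogonal h⟩,
    _, hp, (sub_add_cancel _ _).symm⟩

theorem mem_kerL2_A {φ θ α : Linf} {f : L2} :
    f ∈ kerL2 (A φ θ α) ↔ f ∈ K θ ∧ M φ f ∈ (K α)ᗮ := by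
  constructor
  · rintro ⟨x, hx, rfl⟩
    have hx' : (K α).orthogonalProjectionOnto (M φ x) = 0 := hx
    exact ⟨x.2, Submodule.orthogonalProjectionOnto_eq_zero_iff.1 hx'⟩
  · rintro ⟨hf, h⟩
    have h' : A φ θ α ⟨f, hf⟩ = 0 := by
      rw [← Submodule.orthogonalProjectionOnto_eq_zero_iff] at h
      exact h
    exact ⟨⟨f, hf⟩, h', rfl⟩

theorem mem_K_orthogonal_iff {α : Linf} (hα : IsInner α) {h : L2} (hh : h ∈ H2) :
    h ∈ (K α)ᗮ ↔ h ∈ mulSpace α H2 := by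
  constructor
  · intro hK
    obtain ⟨g, hg, p, hp, rfl⟩ := exists_mem_K_add hα hh
    have h1 := (Submodule.mem_orthogonal _ _).1 hK g hg
    rw [inner_add_right, inner_eq_zero_symm.1 (hg.2 p hp), add_zero, inner_self_eq_zero] at h1
    rwa [h1, zero_add]
  · exact fun hp => (Submodule.mem_orthogonal _ _).2 fun g hg => inner_eq_zero_symm.1 (hg.2 h hp)

theorem adjoint_A (φ α θ : Linf) : ContinuousLinearMap.adjoint (A φ α θ) = A (star φ) θ α := by
  symm
  rw [ContinuousLinearMap.eq_adjoint_iff]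
  intro x y
  have h1 : inner ℂ (A (star φ) θ α x) y = inner ℂ (M (star φ) x) (y : L2) :=
    Submodule.inner_orthogonalProjectionOnto_eq_of_mem_right y _
  have h2 : inner ℂ x (A φ α θ y) = inner ℂ (x : L2) (M φ y) :=
    Submodule.inner_orthogonalProjectionOnto_eq_of_mem_left x _
  rw [h1, h2, inner_M_left, star_star]

theorem star_quot (a b : Linf) : star (quot a b) = quot b a := by
  apply Lp.ext
  filter_upwards [coeFn_star (quot a b), coeFn_mul a (star b), coeFn_mul b (star a),
    coeFn_star a, coeFn_star b] with x h1 h2 h3 h4 h5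
  rw [h1, quot, h2, quot, h3, h4, h5, star_mul', star_star, mul_comm]

theorem kerL2_A_eq {α θ φ φi ψ : Linf} (hα : IsInner α) (hφ : IsHinf φ)
    (hφi : IsInnerFactor φi (toL2 φ)) (hψ : IsGCD ψ α φi) :
    kerL2 (A φ θ α) = K θ ⊓ mulSpace (quot α ψ) H2 := by
  have hcl := hψ.closure_sup_eq hα hφi.1
  obtain ⟨hψi, hψα, hψφ, -⟩ := hψ
  ext f
  rw [mem_kerL2_A, Submodule.mem_inf]
  refine and_congr_right fun hf => ?_
  rw [mem_K_orthogonal_iff hα (M_mem_H2 hφ hf.1), mem_mulSpace hψα.2, mem_mulSpace hα.2, star_quot,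
    M_quot, M_comm]
  constructor
  · intro h
    -- The multipliers of `ᾱf` include `α` since `f ∈ H²`, and `φ` by assumption.
    have hle : mulSpace ψ H2 ≤ multipliers (M (star α) f) := by
      rw [← hcl]
      refine Submodule.topologicalClosure_minimal _ (sup_le ?_ ?_)
        (Submodule.isClosed_orthogonal _)
      · refine mulSpace_le_of_toL2_mem (Submodule.isClosed_orthogonal _) (M_mem_multipliers _) ?_
        rw [toL2_mem_multipliers, M_M_star hα.2]
        exact hf.1
      · refine hφi.mulSpace_le (Submodule.isClosed_orthogonal _) (M_mem_multipliers _) ?_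
        rwa [toL2_mem_multipliers]
    rw [M_comm, ← toL2_mem_multipliers, ← M_one]
    exact hle (M_mem_mulSpace (by simpa using fourierLp_mem_H2 0))
  · intro h
    -- Multiplying `ψᾱf ∈ H²` by `φ` lands in `φi H² ⊆ ψH²`; then cancel `ψ`.
    have h1 := (divides_iff hψi hφi.1).1 hψφ (hφi.M_mem h)
    rwa [mem_mulSpace hψi.2, M_comm, M_comm (star α), M_star_M hψi.2] at h1

/-- Write `f = (α/ψ)g`. Since `(α/ψ)(θψ/α) = θ`, `f` is orthogonal to `θH²` iff `g` is orthogonal to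
`(θψ/α)H²`. -/
theorem inf_mulSpace_eq {α θ ψ : Linf} (hψα : Divides ψ α) :
    K θ ⊓ mulSpace (quot α ψ) H2 = mulSpace (quot α ψ) (K (quot (mul θ ψ) α)) := by
  ext f
  rw [Submodule.mem_inf, mem_mulSpace hψα.2, mem_mulSpace hψα.2]
  simp only [mem_K, mem_mulSpace_orthogonal]
  obtain ⟨g, rfl⟩ : ∃ g, f = M (quot α ψ) g := ⟨_, (M_M_star hψα.2 f).symm⟩
  have key : ∀ h, inner ℂ (M (quot (mul θ ψ) α) h) g = inner ℂ (M θ h) (M (quot α ψ) g) := by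
    intro h
    rw [M_quot, M_mul, inner_M_right, star_quot, M_quot, M_comm ψ]
  simp only [M_star_M hψα.2, key]
  exact ⟨fun h => ⟨h.2, h.1.2⟩, fun h => ⟨⟨M_mem_H2 hψα.1 h.1, h.2⟩, h.1⟩⟩

theorem kerL2_A_star_eq {α θ φ φi ψ χ : Linf} (hα : IsInner α) (hθ : IsInner θ)
    (hφ : IsHinf φ) (hφi : IsInnerFactor φi (toL2 φ)) (hψ : IsGCD ψ α φi)
    (hθα : Divides θ α) (hχ : IsGCD χ θ ψ) : kerL2 (A (star φ) θ α) = K χ := by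
  have hχcl : (mulSpace χ H2)ᗮ = (mulSpace θ H2)ᗮ ⊓ (mulSpace ψ H2)ᗮ := by
    rw [← hχ.closure_sup_eq hθ hψ.1, Submodule.orthogonal_closure, Submodule.inf_orthogonal]
  have hψcl : (mulSpace ψ H2)ᗮ = (mulSpace α H2)ᗮ ⊓ (mulSpace φi H2)ᗮ := by
    rw [← hψ.closure_sup_eq hα hφi.1, Submodule.orthogonal_closure, Submodule.inf_orthogonal]
  have hle := (divides_iff hθ hα).1 hθα
  ext f
  rw [mem_kerL2_A, mem_K, mem_K, hχcl, hψcl, Submodule.mem_inf, Submodule.mem_inf]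
  constructor
  · rintro ⟨⟨hf, hfθ⟩, hk⟩
    refine ⟨hf, hfθ, Submodule.orthogonal_le hle hfθ, ?_⟩
    -- Split `H²` as `K α ⊕ αH²`: the kernel condition handles the first summand, and `φαH² ⊆ αH² ⊆
    -- θH²` the second.
    have hφH : f ∈ (mulSpace φ H2)ᗮ := by
      refine mem_mulSpace_orthogonal.2 fun h hh => ?_
      obtain ⟨g, hg, p, ⟨q, hq, hp⟩, rfl⟩ := exists_mem_K_add hα hh
      replace hp : M α q = p := hp
      rw [inner_M_left, inner_add_left, (Submodule.mem_orthogonal _ _).1 hk g hg, zero_add,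
        ← inner_M_left, ← hp, M_comm]
      exact (Submodule.mem_orthogonal _ _).1 hfθ _ (hle (M_mem_mulSpace (M_mem_H2 hφ hq)))
    -- The closure of `φH²` is shift invariant and contains `φ`, so it contains `φi H²`.
    rw [← Submodule.orthogonal_closure] at hφH
    refine Submodule.orthogonal_le (hφi.mulSpace_le (Submodule.isClosed_topologicalClosure _)
      (topologicalClosure_M_mem (M_mem_mulSpace_H2 φ))
      (Submodule.le_topologicalClosure _ ?_)) hφH
    rw [← M_one]
    exact M_mem_mulSpace (by simpa using fourierLp_mem_H2 0)
  · rintro ⟨hf, hfθ, hfα, hfφ⟩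
    refine ⟨⟨hf, hfθ⟩, (Submodule.mem_orthogonal _ _).2 fun g hg => ?_⟩
    rw [← inner_M_left]
    exact (Submodule.mem_orthogonal _ _).1 hfφ _ (hφi.M_mem hg.1)

end HardyCircle

end

open HardyCircle in
theorem theorem4p1 (α θ φ : Linf)
    (hα : IsInner α) (hαc : ¬ IsConst α) (hθ : IsInner θ) (hθc : ¬ IsConst θ)
    (hφ : IsHinf φ) (hφ0 : φ ≠ 0) :
    (∃ φi : Linf, IsInnerFactor φi (toL2 φ)) ∧
    ∀ φi : Linf, IsInnerFactor φi (toL2 φ) →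
      (∃ ψ : Linf, IsGCD ψ α φi) ∧
      ∀ ψ : Linf, IsGCD ψ α φi →
        (kerL2 (A φ θ α) = K θ ⊓ mulSpace (quot α ψ) H2 ∧
          (Divides (quot α ψ) θ →
            kerL2 (A φ θ α) = mulSpace (quot α ψ) (K (quot (mul θ ψ) α)))) ∧
        (Divides θ α →
          kerL2 (A (star φ) θ α) = kerL2 (ContinuousLinearMap.adjoint (A φ α θ)) ∧
          (∃ χ : Linf, IsGCD χ θ ψ) ∧
          ∀ χ : Linf, IsGCD χ θ ψ → kerL2 (A (star φ) θ α) = K χ) := by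
  refine ⟨exists_isInnerFactor hφ hφ0, fun φi hφi => ⟨exists_isGCD hα hφi.1, fun ψ hψ =>
    ⟨⟨kerL2_A_eq hα hφ hφi hψ, fun _ => ?_⟩, fun hθα => ⟨?_, exists_isGCD hθ hψ.1, fun χ hχ =>
      kerL2_A_star_eq hα hθ hφ hφi hψ hθα hχ⟩⟩⟩⟩
  · rw [kerL2_A_eq hα hφ hφi hψ, inf_mulSpace_eq hψ.2.1]
  · rw [adjoint_A]
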